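/- Let $\mathbf k$ be a field and let $\mathcal K$ be an abstract simplicial complex on the vertex set $[m]=\{1,\dots,m\}$ (a family of subsets of $[m]$ closed under passing to subsets and containing $\varnothing$ and every $\{j\}$, $j\in[m]$). For $\omega\subseteq[m]$ let $\mathcal K|_\omega=\{\sigma\in\mathcal K:\sigma\subseteq\omega\}$. Let $\mathbf k(\mathcal K)=\mathbf k[v_1,\dots,v_m]/\langle \prod_{j\in\tau}v_j : \tau\notin\mathcal K\rangle$ be the Stanley–Reisner ring; for $h\colon[m]\to\mathbb N$ write $v^h=\prod_j v_j^{h(j)}$ and $\operatorname{supp}h=\{j:h(j)\neq0\}$. Let $\alpha=\{\alpha_1,\dots,\alpha_r\}$ be a partition of $[m]$ into $r$ nonempty disjoint subsets that is nondegenerate for $\mathcal K$, i.e. the two vertices of any $1$-simplex of $\mathcal K$ belong to different $\alpha_i$. For $L\subseteq[r]$ put $\omega_L=\bigcup_{i\in L}\alpha_i$, and for $\sigma\subseteq[m]$ put $\mathrm I_\alpha(\sigma)=\{i\in[r]:\sigma\cap\alpha_i\neq\varnothing\}$. View $\mathbf k(\mathcal K)$ as a module over $\mathbf k[u_1,\dots,u_r]$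 via $u_i\mapsto\sum_{j\in\alpha_i}v_j$, and let $\Lambda_{\mathbf k}[t_1,\dots,t_r]\otimes_{\mathbf k}\mathbf k(\mathcal K)$ be its Koszul complex, where $\Lambda_{\mathbf k}[t_1,\dots,t_r]$ is the exterior algebra, the differential is the $\mathbf k(\mathcal K)$-linear antiderivation with $d(t_i)=\sum_{j\in\alpha_i}v_j$, and $t_I=t_{i_1}\cdots t_{i_s}$ ($I=\{i_1<\dots<i_s\}\subseteq[r]$) has cohomological degree $-|I|$. For $L\subseteq[r]$, the $\mathbf k$-span of the elements $t_I v^h$ with $\operatorname{supp}h\in\mathcal K$ and $\mathrm I_\alpha(\operatorname{supp}h)\cup I=L$ is a subcomplex $(\Lambda_{\mathbf k}[t_1,\dots,t_r]\otimes\mathbf k(\mathcal K))^L$, and one defines $$\mathrm{Tor}_{q,L}^{\mathbf k[u_1,\dots,u_r]}(\mathbf k,\mathbf k(\mathcal K)):=H^{-q}\big((\Lambda_{\mathbf k}[t_1,\dots,t_r]\otimes\mathbf k(\mathcal K))^L\big),\qquad q\ge 0.$$ Then for every $q\ge0$ and every $L\subseteq[r]$ there is an isomorphism of $\mathbf k$-vector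 spaces $$\mathrm{Tor}_{q,L}^{\mathbf k[u_1,\dots,u_r]}(\mathbf k,\mathbf k(\mathcal K))\;\cong\;\widetilde H^{\,|L|-q-1}(\mathcal K|_{\omega_L};\mathbf k),$$ where $\widetilde H^{*}$ is reduced simplicial cohomology, i.e. the cohomology of the simplicial cochain complex augmented by the empty simplex in degree $-1$ (so that $\widetilde H^{-1}(\{\varnothing\};\mathbf k)=\mathbf k$). -/

import Mathlib

open scoped TensorProduct

universe u

noncomputable section

namespace ColoredTor

/-! ### Cochain complexes of internally graded differential modules -/

section Graded

variable {k : Type u} [Field k] {E : Type u} [AddCommGroup E] [Module k E]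

/-- The cochain complex `⋯ → C j → C (j + 1) → ⋯` cut out of a module `E` with an endomorphism
`d` of square zero by submodules `C j` such that `d` maps `C j` into `C (j + 1)`. -/
def gradedComplex (d : E →ₗ[k] E) (C : ℤ → Submodule k E) (hdd : ∀ x, d (d x) = 0)
    (hC : ∀ j, ∀ x ∈ C j, d x ∈ C (j + 1)) : CochainComplex (ModuleCat.{u} k) ℤ where
  X j := ModuleCat.of k (C j)
  d i j := if h : i + 1 = j then
      ModuleCat.ofHom (d.restrict (fun x hx => h ▸ hC i x hx)) else 0
  shape i j h := dif_neg h
  d_comp_d' i j l hij hjl := by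
    have h1 : i + 1 = j := hij
    have h2 : j + 1 = l := hjl
    rw [dif_pos h1, dif_pos h2]
    refine ModuleCat.hom_ext (LinearMap.ext fun x => ?_)
    exact Subtype.ext (hdd x.1)

end Graded

theorem sum_sum_eq_zero_of_antisymm {ι M : Type*} [AddCommGroup M] (s : Finset ι) (f : ι → ι → M)
    (hdiag : ∀ i ∈ s, f i i = 0) (hanti : ∀ i ∈ s, ∀ j ∈ s, f i j = -f j i) :
    ∑ i ∈ s, ∑ j ∈ s, f i j = 0 := by
  classical
  rw [← Finset.sum_product']
  refine Finset.sum_involution (fun p _ => p.swap) ?_ ?_ ?_ ?_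
  · rintro ⟨i, j⟩ h
    rw [Finset.mem_product] at h
    simp [hanti i h.1 j h.2]
  · rintro ⟨i, j⟩ h hne heq
    rw [Finset.mem_product] at h
    simp only [Prod.swap_prod_mk, Prod.mk.injEq] at heq
    obtain rfl : j = i := heq.1
    exact hne (hdiag j h.1)
  · rintro ⟨i, j⟩ h
    rw [Finset.mem_product] at h ⊢
    exact ⟨h.2, h.1⟩
  · rintro ⟨i, j⟩ h
    rfl

/-! ### Simplicial complexes and reduced simplicial cohomology -/

section Simplicial

variable {V : Type}

/-- All simplices of `K`, the empty simplex included. (Mathlib lists only the nonempty ones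
in `K.faces`.) -/
def simplices (K : PreAbstractSimplicialComplex V) : Set (Finset V) := insert ∅ K.faces

theorem simplices_of_subset (K : PreAbstractSimplicialComplex V) {σ τ : Finset V}
    (hτ : τ ∈ simplices K) (h : σ ⊆ τ) : σ ∈ simplices K := by
  rcases σ.eq_empty_or_nonempty with rfl | hσ
  · exact Or.inl rfl
  · rcases hτ with rfl | hτ
    · exact absurd (Finset.subset_empty.mp h) hσ.ne_empty
    · exact Or.inr ((K.isRelLowerSet_faces hτ).2 h hσ)

/-- The full subcomplex `K|_ω`, consisting of the simplices of `K` contained in `ω`. -/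
def fullSubcomplex (K : PreAbstractSimplicialComplex V) (ω : Finset V) :
    PreAbstractSimplicialComplex V where
  faces := {σ | σ ∈ K.faces ∧ σ ⊆ ω}
  isRelLowerSet_faces := fun {_} hσ =>
    ⟨(K.isRelLowerSet_faces hσ.1).1, fun _ hts ht =>
      ⟨(K.isRelLowerSet_faces hσ.1).2 hts ht, Finset.Subset.trans hts hσ.2⟩⟩

variable [LinearOrder V]

/-- The sign `(-1)^c`, where `c` is the number of elements of `τ` that are less than `v`. -/
def vertexSign (k : Type u) [Field k] (v : V) (τ : Finset V) : k :=
  (-1) ^ (τ.filter (· < v)).card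

/-- The coboundary of the augmented (reduced) simplicial cochain complex, every simplex being
oriented by the order of the vertices. -/
def coboundary (k : Type u) [Field k] (K : PreAbstractSimplicialComplex V) :
    (simplices K → k) →ₗ[k] (simplices K → k) where
  toFun f τ := ∑ v ∈ τ.1, vertexSign k v τ.1 *
    f ⟨τ.1.erase v, simplices_of_subset K τ.2 (Finset.erase_subset v τ.1)⟩
  map_add' f g := by
    ext τ
    simp [mul_add, Finset.sum_add_distrib]
  map_smul' c f := by
    ext τ
    simp [Finset.mul_sum, mul_left_comm]

/-- The cochains of degree `j`: functions supported on the simplices of dimension `j`, that is,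
of cardinality `j + 1`. In degree `-1` there is the empty simplex. -/
def cochains (k : Type u) [Field k] (K : PreAbstractSimplicialComplex V) (j : ℤ) :
    Submodule k (simplices K → k) where
  carrier := {f | ∀ τ, (τ.1.card : ℤ) ≠ j + 1 → f τ = 0}
  zero_mem' _ _ := rfl
  add_mem' hf hg τ hτ := by simp [hf τ hτ, hg τ hτ]
  smul_mem' c f hf τ hτ := by simp [hf τ hτ]

theorem vertexSign_erase_of_lt (k : Type u) [Field k] {v w : V} (τ : Finset V) (h : w < v) :
    vertexSign k w (τ.erase v) = vertexSign k w τ := by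
  unfold vertexSign
  congr 2
  ext x
  simp only [Finset.mem_filter, Finset.mem_erase]
  exact ⟨fun hx => ⟨hx.1.2, hx.2⟩, fun hx => ⟨⟨(hx.2.trans h).ne, hx.1⟩, hx.2⟩⟩

theorem vertexSign_erase_of_gt (k : Type u) [Field k] {v w : V} (τ : Finset V) (hv : v ∈ τ)
    (h : v < w) : vertexSign k w (τ.erase v) = -vertexSign k w τ := by
  unfold vertexSign
  have h1 : (τ.erase v).filter (· < w) = (τ.filter (· < w)).erase v := by
    ext x
    simp only [Finset.mem_filter, Finset.mem_erase]
    tauto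
  have h2 : v ∈ τ.filter (· < w) := Finset.mem_filter.mpr ⟨hv, h⟩
  rw [h1, ← Finset.card_erase_add_one h2, pow_succ]
  ring

theorem coboundary_coboundary (k : Type u) [Field k] (K : PreAbstractSimplicialComplex V)
    (f : simplices K → k) : coboundary k K (coboundary k K f) = 0 := by
  ext τ
  let g : V → V → k := fun v w => if v = w then 0 else
    vertexSign k v τ.1 * (vertexSign k w (τ.1.erase v) *
      f ⟨(τ.1.erase v).erase w, simplices_of_subset K τ.2
        ((Finset.erase_subset w _).trans (Finset.erase_subset v τ.1))⟩)
  have hg : coboundary k K (coboundary k K f) τ = ∑ v ∈ τ.1, ∑ w ∈ τ.1, g v w := by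
    simp only [coboundary, LinearMap.coe_mk, AddHom.coe_mk, Finset.mul_sum]
    refine Finset.sum_congr rfl fun v hv => ?_
    rw [← Finset.add_sum_erase τ.1 (g v) hv]
    simp only [g, if_true, zero_add]
    refine Finset.sum_congr rfl fun w hw => ?_
    rw [if_neg (Finset.ne_of_mem_erase hw).symm]
  rw [hg]
  refine sum_sum_eq_zero_of_antisymm _ _ (fun v _ => if_pos rfl) fun v hv w hw => ?_
  rcases eq_or_ne v w with rfl | hvw
  · simp [g]
  · simp only [g, if_neg hvw, if_neg hvw.symm, Finset.erase_right_comm (a := w) (b := v)]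
    rcases lt_or_gt_of_ne hvw with h | h
    · rw [vertexSign_erase_of_gt k τ.1 hv h, vertexSign_erase_of_lt k τ.1 h]
      ring
    · rw [vertexSign_erase_of_gt k τ.1 hw h, vertexSign_erase_of_lt k τ.1 h]
      ring

theorem coboundary_mem_cochains (k : Type u) [Field k] (K : PreAbstractSimplicialComplex V)
    (j : ℤ) (f : simplices K → k) (hf : f ∈ cochains k K j) :
    coboundary k K f ∈ cochains k K (j + 1) := by
  intro τ hτ
  refine Finset.sum_eq_zero fun v hv => ?_
  rw [hf, mul_zero]
  intro h
  apply hτ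
  have := Finset.card_erase_add_one hv
  simp only at h
  omega

/-- The augmented simplicial cochain complex of `K` with coefficients in `k`. -/
def reducedCochainComplex (k : Type u) [Field k] (K : PreAbstractSimplicialComplex V) :
    CochainComplex (ModuleCat.{u} k) ℤ :=
  gradedComplex (coboundary k K) (cochains k K) (coboundary_coboundary k K)
    (coboundary_mem_cochains k K)

/-- The reduced simplicial cohomology `H̃^j(K; k)`, for every integer `j`. -/
def reducedCohomology (k : Type u) [Field k] (K : PreAbstractSimplicialComplex V) (j : ℤ) :
    ModuleCat.{u} k :=
  (reducedCochainComplex k K).homology j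

end Simplicial

/-! ### Stanley–Reisner rings -/

section StanleyReisner

variable {V : Type}

/-- The Stanley–Reisner ideal, generated by the squarefree monomials of the nonsimplices. -/
def stanleyReisnerIdeal (k : Type u) [Field k] (K : PreAbstractSimplicialComplex V) :
    Ideal (MvPolynomial V k) :=
  Ideal.span {p | ∃ τ : Finset V, τ ∉ simplices K ∧ p = ∏ j ∈ τ, MvPolynomial.X j}

/-- The Stanley–Reisner ring `k(K)`. -/
abbrev StanleyReisnerRing (k : Type u) [Field k] (K : PreAbstractSimplicialComplex V) : Type u :=
  MvPolynomial V k ⧸ stanleyReisnerIdeal k K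

/-- The monomial `v^h` in `k(K)`. -/
def srMonomial (k : Type u) [Field k] (K : PreAbstractSimplicialComplex V) (h : V →₀ ℕ) :
    StanleyReisnerRing k K :=
  Ideal.Quotient.mk _ (MvPolynomial.monomial h 1)

theorem srMonomial_eq_zero (k : Type u) [Field k] (K : PreAbstractSimplicialComplex V)
    (h : V →₀ ℕ) (hh : h.support ∉ simplices K) : srMonomial k K h = 0 := by
  classical
  rw [srMonomial, Ideal.Quotient.eq_zero_iff_mem, MvPolynomial.monomial_eq]
  have h1 : (∏ j ∈ h.support, (MvPolynomial.X j : MvPolynomial V k)) ∣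
      h.prod fun n e => MvPolynomial.X n ^ e :=
    Finset.prod_dvd_prod_of_dvd _ _ fun j hj =>
      dvd_pow_self _ (Finsupp.mem_support_iff.mp hj)
  exact Ideal.mul_mem_left _ _ (Ideal.mem_of_dvd _ h1 (Ideal.subset_span ⟨_, hh, rfl⟩))

end StanleyReisner

/-! ### Colorings -/

/-- A partition of `[m]` into `r` nonempty disjoint blocks, numbered by `[r]`. -/
structure VertexPartition (m r : ℕ) where
  block : Fin r → Finset (Fin m)
  nonempty : ∀ i, (block i).Nonempty
  disjoint : ∀ i i', i ≠ i' → Disjoint (block i) (block i')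
  cover : ∀ j, ∃ i, j ∈ block i

namespace VertexPartition

variable {m r : ℕ} (α : VertexPartition m r)

/-- The two vertices of any 1-simplex of `K` belong to different blocks. -/
def IsNondegenerate (K : PreAbstractSimplicialComplex (Fin m)) : Prop :=
  ∀ a b, a ≠ b → ({a, b} : Finset (Fin m)) ∈ K.faces → ∀ i, ¬(a ∈ α.block i ∧ b ∈ α.block i)

/-- The union `ω_L` of the blocks with index in `L`. -/
def blockUnion (L : Finset (Fin r)) : Finset (Fin m) := L.biUnion α.block

/-- The set of the indices of the blocks that meet `σ`. -/
def colors (σ : Finset (Fin m)) : Finset (Fin r) :=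
  Finset.univ.filter fun i => (σ ∩ α.block i).Nonempty

theorem colors_insert {i : Fin r} {j : Fin m} (hj : j ∈ α.block i) (σ : Finset (Fin m)) :
    α.colors (insert j σ) = insert i (α.colors σ) := by
  ext i'
  simp only [colors, Finset.mem_filter, Finset.mem_univ, true_and, Finset.mem_insert]
  constructor
  · rintro ⟨x, hx⟩
    rw [Finset.mem_inter, Finset.mem_insert] at hx
    rcases hx with ⟨rfl | hx, hx'⟩
    · left
      by_contra hne
      exact Finset.disjoint_left.mp (α.disjoint _ _ hne) hx' hj
    · exact Or.inr ⟨x, Finset.mem_inter.mpr ⟨hx, hx'⟩⟩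
  · rintro (rfl | ⟨x, hx⟩)
    · exact ⟨j, Finset.mem_inter.mpr ⟨Finset.mem_insert_self _ _, hj⟩⟩
    · rw [Finset.mem_inter] at hx
      exact ⟨x, Finset.mem_inter.mpr ⟨Finset.mem_insert_of_mem hx.1, hx.2⟩⟩

end VertexPartition

/-! ### The exterior algebra on `t_1, …, t_r` -/

section Exterior

variable (k : Type u) [Field k] {r : ℕ}

/-- The exterior algebra `Λ[t_1, …, t_r]`. -/
abbrev Ext (r : ℕ) : Type u := ExteriorAlgebra k (Fin r → k)

/-- The generator `t_i`. -/
def tGen (i : Fin r) : Ext k r := ExteriorAlgebra.ι k (Pi.single i 1)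

/-- The product of the `t_i` along a list. -/
def tList (l : List (Fin r)) : Ext k r := (l.map (tGen k)).prod

/-- The monomial `t_I = t_{i_1} ⋯ t_{i_s}` for `I = {i_1 < ⋯ < i_s}`. -/
def tMonomial (I : Finset (Fin r)) : Ext k r := tList k (I.sort (· ≤ ·))

/-- The contraction of `Λ[t_1, …, t_r]` by the `i`-th coordinate: the antiderivation that sends
`t_i` to `1` and the other generators to `0`. -/
def tContract (i : Fin r) : Ext k r →ₗ[k] Ext k r :=
  CliffordAlgebra.contractLeft (Q := (0 : QuadraticForm k (Fin r → k))) (LinearMap.proj i)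

theorem tContract_tGen_mul (i i' : Fin r) (x : Ext k r) :
    tContract k i (tGen k i' * x) =
      (if i = i' then (1 : k) else 0) • x - tGen k i' * tContract k i x := by
  have h := CliffordAlgebra.contractLeft_ι_mul (Q := (0 : QuadraticForm k (Fin r → k)))
    (LinearMap.proj i) (Pi.single i' 1) x
  rw [LinearMap.proj_apply, Pi.single_apply] at h
  exact h

theorem tContract_tList_of_notMem (i : Fin r) (l : List (Fin r)) (hi : i ∉ l) :
    tContract k i (tList k l) = 0 := by
  induction l with
  | nil => exact CliffordAlgebra.contractLeft_one (Q := (0 : QuadraticForm k (Fin r → k))) _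
  | cons a l ih =>
    rw [List.mem_cons, not_or] at hi
    have h : tList k (a :: l) = tGen k a * tList k l := by simp [tList]
    rw [h, tContract_tGen_mul, if_neg hi.1, ih hi.2, zero_smul, mul_zero, sub_zero]

theorem tContract_tList (i : Fin r) (l : List (Fin r)) (hl : l.Nodup) (hi : i ∈ l) :
    tContract k i (tList k l) = (-1 : k) ^ (l.idxOf i) • tList k (l.erase i) := by
  induction l with
  | nil => simp at hi
  | cons a l ih =>
    rw [List.nodup_cons] at hl
    have h : ∀ l', tList k (a :: l') = tGen k a * tList k l' := fun l' => by simp [tList]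
    rw [h, tContract_tGen_mul]
    rcases eq_or_ne i a with rfl | hne
    · rw [tContract_tList_of_notMem k i l hl.1]
      simp
    · have hi' : i ∈ l := (List.mem_cons.mp hi).resolve_left hne
      rw [ih hl.2 hi', if_neg hne, List.erase_cons_tail (by simpa using hne.symm), h,
        List.idxOf_cons_ne _ hne.symm, zero_smul, zero_sub, mul_smul_comm, pow_succ, mul_neg_one,
        neg_smul]

theorem tContract_tMonomial_of_notMem (i : Fin r) (I : Finset (Fin r)) (hi : i ∉ I) :
    tContract k i (tMonomial k I) = 0 :=
  tContract_tList_of_notMem k i _ (by simpa using hi)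

theorem tContract_tMonomial (i : Fin r) (I : Finset (Fin r)) (hi : i ∈ I) :
    tContract k i (tMonomial k I) =
      (-1 : k) ^ ((I.sort (· ≤ ·)).idxOf i) • tMonomial k (I.erase i) := by
  rw [tMonomial, tContract_tList k i _ (Finset.sort_nodup _ _) (by simpa using hi), tMonomial]
  congr 2
  refine List.Perm.eq_of_pairwise' (r := (· ≤ ·)) ?_ (Finset.pairwise_sort _ _) ?_
  · exact List.Pairwise.sublist List.erase_sublist (Finset.pairwise_sort _ _)
  · rw [List.perm_ext_iff_of_nodup ((Finset.sort_nodup _ _).erase _) (Finset.sort_nodup _ _)]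
    intro x
    rw [(Finset.sort_nodup _ _).mem_erase_iff]
    simp

end Exterior

/-! ### The Koszul complex and its multigrading -/

section Koszul

variable (k : Type u) [Field k] {m r : ℕ} (K : PreAbstractSimplicialComplex (Fin m))
  (α : VertexPartition m r)

/-- The homomorphism `k[u_1, …, u_r] → k(K)`, `u_i ↦ ∑_{j ∈ α_i} v_j`, through which `k(K)` is
a module over `k[u_1, …, u_r]`. -/
def paramHom : MvPolynomial (Fin r) k →ₐ[k] StanleyReisnerRing k K :=
  MvPolynomial.aeval fun i =>
    ∑ j ∈ α.block i, Ideal.Quotient.mk (stanleyReisnerIdeal k K) (MvPolynomial.X j)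

/-- The action of a polynomial of `k[u_1, …, u_r]` on the module `k(K)`: multiplication by its
image under `paramHom`. -/
def paramAction (p : MvPolynomial (Fin r) k) :
    StanleyReisnerRing k K →ₗ[k] StanleyReisnerRing k K :=
  LinearMap.mulLeft k (paramHom k K α p)

theorem paramAction_apply (p : MvPolynomial (Fin r) k) (x : StanleyReisnerRing k K) :
    paramAction k K α p x = paramHom k K α p * x := rfl

/-- The underlying module `Λ[t_1, …, t_r] ⊗ k(K)` of the Koszul complex. -/
abbrev Koszul (r : ℕ) : Type u := Ext k r ⊗[k] StanleyReisnerRing k K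

/-- The Koszul differential, the `k(K)`-linear antiderivation with `d t_i = u_i · 1`. -/
def koszulD : Koszul k K r →ₗ[k] Koszul k K r :=
  ∑ i : Fin r, TensorProduct.map (tContract k i) (paramAction k K α (MvPolynomial.X i))

theorem koszulD_tmul (x : Ext k r) (a : StanleyReisnerRing k K) :
    koszulD k K α (x ⊗ₜ a) =
      ∑ i : Fin r, tContract k i x ⊗ₜ[k] (paramHom k K α (MvPolynomial.X i) * a) := by
  simp [koszulD, LinearMap.sum_apply, paramAction_apply]

theorem koszulD_koszulD (x : Koszul k K r) : koszulD k K α (koszulD k K α x) = 0 := by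
  induction x using TensorProduct.induction_on with
  | zero => simp
  | add x y hx hy => rw [map_add, map_add, hx, hy, add_zero]
  | tmul x a =>
    simp only [koszulD_tmul, map_sum]
    refine sum_sum_eq_zero_of_antisymm _ _ (fun i _ => ?_) fun i _ j _ => ?_
    · rw [tContract, CliffordAlgebra.contractLeft_contractLeft, TensorProduct.zero_tmul]
    · rw [tContract, tContract, CliffordAlgebra.contractLeft_comm, TensorProduct.neg_tmul,
        mul_left_comm]

/-- The piece of cohomological degree `j` and multidegree `L` of the Koszul complex, spanned by
the `t_I v^h` with `supp h ∈ K`, `-|I| = j` and `I_α(supp h) ∪ I = L`. -/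
def koszulPiece (L : Finset (Fin r)) (j : ℤ) : Submodule k (Koszul k K r) :=
  Submodule.span k {x | ∃ (I : Finset (Fin r)) (h : Fin m →₀ ℕ), h.support ∈ simplices K ∧
    α.colors h.support ∪ I = L ∧ -(I.card : ℤ) = j ∧ x = tMonomial k I ⊗ₜ srMonomial k K h}

theorem koszulD_mem_koszulPiece (L : Finset (Fin r)) (j : ℤ) (x : Koszul k K r)
    (hx : x ∈ koszulPiece k K α L j) : koszulD k K α x ∈ koszulPiece k K α L (j + 1) := by
  induction hx using Submodule.span_induction with
  | zero => simp
  | add x y _ _ hx hy => rw [map_add]; exact add_mem hx hy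
  | smul c x _ hx => rw [map_smul]; exact Submodule.smul_mem _ _ hx
  | mem x hx =>
    obtain ⟨I, h, -, hL, hI, rfl⟩ := hx
    rw [koszulD_tmul]
    refine Submodule.sum_mem _ fun i _ => ?_
    by_cases hi : i ∈ I
    swap
    · rw [tContract_tMonomial_of_notMem k i I hi, TensorProduct.zero_tmul]
      exact zero_mem _
    rw [tContract_tMonomial k i I hi, ← TensorProduct.smul_tmul']
    refine Submodule.smul_mem _ _ ?_
    rw [paramHom, MvPolynomial.aeval_X, Finset.sum_mul, TensorProduct.tmul_sum]
    refine Submodule.sum_mem _ fun v hv => ?_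
    have hmul : Ideal.Quotient.mk (stanleyReisnerIdeal k K) (MvPolynomial.X v) *
        srMonomial k K h = srMonomial k K (Finsupp.single v 1 + h) := by
      rw [srMonomial, srMonomial, ← map_mul, MvPolynomial.X, MvPolynomial.monomial_mul, one_mul]
    rw [hmul]
    by_cases hs : (Finsupp.single v 1 + h).support ∈ simplices K
    swap
    · rw [srMonomial_eq_zero k K _ hs, TensorProduct.tmul_zero]
      exact zero_mem _
    refine Submodule.subset_span ⟨I.erase i, _, hs, ?_, ?_, rfl⟩
    · have hsupp : (Finsupp.single v 1 + h).support = insert v h.support := by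
        ext w
        rcases eq_or_ne w v with rfl | hw
        · simp
        · simp [hw]
      rw [hsupp, α.colors_insert hv, ← hL]
      ext w
      simp only [Finset.mem_union, Finset.mem_insert, Finset.mem_erase]
      rcases eq_or_ne w i with rfl | hw
      · simp [hi]
      · simp [hw]
    · have := Finset.card_erase_add_one hi
      omega

/-- The subcomplex `(Λ[t_1, …, t_r] ⊗ k(K))^L` of the Koszul complex, with `t_I v^h` in
cohomological degree `-|I|`. -/
def koszulComplex (L : Finset (Fin r)) : CochainComplex (ModuleCat.{u} k) ℤ :=
  gradedComplex (koszulD k K α) (koszulPiece k K α L) (koszulD_koszulD k K α)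
    (koszulD_mem_koszulPiece k K α L)

/-- The multigraded piece `Tor_{q, L}` of `Tor^{k[u_1, …, u_r]}(k, k(K))`: the cohomology in
degree `-q` of the multidegree `L` part of the Koszul complex. -/
def multigradedTor (q : ℕ) (L : Finset (Fin r)) : ModuleCat.{u} k :=
  (koszulComplex k K α L).homology (-(q : ℤ))

end Koszul

end ColoredTor

end

/-! The Koszul complex contracts, in each multidegree `L`, onto the span of the squarefree elements
`t_{L ∖ I_α(σ)} v_σ` with `σ` a simplex of `K|_{ω_L}`, and this span is the augmented simplicial
cochain complex up to signs and a shift of degree.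

By nondegeneracy a simplex has at most one vertex of each color (`IsNondegenerate.injOn_color`).
Hence, if color `i` occurs in `supp h` at the vertex `j`, multiplication by `u_i` sends `v^h` to
`v_j v^h`, and `divColor` undoes it without changing the support. Let `s_i` be multiplication by
`t_i` combined with this division. Then `d s_i + s_i d` is diagonal on the monomials `t_I v^h`: it
is the identity if `v^h` contains a square of color `i`, or if `i` lies both in `I` and in `I_α(supp
h)`, and zero otherwise. So `1 - d s_i - s_i d` is a projection homotopic to the identity
(`exists_isHomotopicToId_color`). The product over all colors (`exists_isHomotopicToId`) keeps
exactly the `t_I v^h` with `h` squarefree and `I` disjoint from `I_α(supp h)`; in multidegree `L`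
this forces `I = L ∖ I_α(supp h)` (`eq_of_isReducedAt`).

On the surviving elements `d` adds a vertex to `σ`, with the sign given by the position of its color
in `L ∖ I_α(σ)`; the coboundary uses the position of the vertex in `σ`. The sign
`(-1)^orientationExponent` turns one into the other (`neg_one_pow_orientationExponent`), which makes
`cochainEmbedding` a chain map. As `-|L ∖ I_α(σ)| = dim σ - (|L| - 1)`, degree `-q` corresponds to
cochain degree `|L| - q - 1`. -/

noncomputable section

namespace ColoredTor

/-! ### Comparison of the homology of graded differential modules -/

section Comparison

open CategoryTheory

variable {k : Type u} [Field k]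

/-- A linear map between the middle terms of two short complexes which maps cycles to cycles,
reflects and preserves boundaries, and hits every homology class induces an isomorphism in
homology. -/
theorem nonempty_homology_equiv (S T : ShortComplex (ModuleCat.{u} k)) (φ : S.X₂ →ₗ[k] T.X₂)
    (hker : ∀ x, S.g.hom x = 0 → T.g.hom (φ x) = 0)
    (hbd : ∀ x, S.g.hom x = 0 → ((∃ y, T.f.hom y = φ x) ↔ ∃ y, S.f.hom y = x))
    (hsurj : ∀ z, T.g.hom z = 0 → ∃ x, S.g.hom x = 0 ∧ ∃ y, T.f.hom y = z - φ x) :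
    Nonempty (S.homology ≃ₗ[k] T.homology) := by
  let φZ : LinearMap.ker S.g.hom →ₗ[k] LinearMap.ker T.g.hom := φ.restrict hker
  -- The first isomorphism theorem for `ψ`: `hsurj` is its surjectivity, and `hbd` says that its
  -- kernel consists of the boundaries.
  let ψ : LinearMap.ker S.g.hom →ₗ[k]
      LinearMap.ker T.g.hom ⧸ LinearMap.range T.moduleCatToCycles :=
    (Submodule.mkQ _).comp φZ
  have hψs : Function.Surjective ψ := by
    intro z
    obtain ⟨⟨z, hz⟩, rfl⟩ := Submodule.mkQ_surjective _ z
    obtain ⟨x, hx, y, hy⟩ := hsurj z hz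
    have h : (⟨z, hz⟩ - φZ ⟨x, hx⟩ : LinearMap.ker T.g.hom) ∈
        LinearMap.range T.moduleCatToCycles := ⟨y, Subtype.ext hy⟩
    exact ⟨⟨x, hx⟩, ((Submodule.Quotient.eq _).mpr h).symm⟩
  have hψk : LinearMap.ker ψ = LinearMap.range S.moduleCatToCycles := by
    ext ⟨x, hx⟩
    have h1 : (⟨x, hx⟩ : LinearMap.ker S.g.hom) ∈ LinearMap.ker ψ ↔ ∃ y, T.f.hom y = φ x := by
      rw [LinearMap.mem_ker]
      refine (Submodule.Quotient.mk_eq_zero _).trans ?_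
      exact ⟨fun ⟨y, hy⟩ => ⟨y, congrArg Subtype.val hy⟩, fun ⟨y, hy⟩ => ⟨y, Subtype.ext hy⟩⟩
    rw [h1, hbd x hx]
    exact ⟨fun ⟨y, hy⟩ => ⟨y, Subtype.ext hy⟩, fun ⟨y, hy⟩ => ⟨y, congrArg Subtype.val hy⟩⟩
  exact ⟨S.moduleCatHomologyIso.toLinearEquiv ≪≫ₗ (Submodule.quotEquivOfEq _ _ hψk).symm ≪≫ₗ
    ψ.quotKerEquivOfSurjective hψs ≪≫ₗ T.moduleCatHomologyIso.toLinearEquiv.symm⟩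

variable {E F : Type u} [AddCommGroup E] [Module k E] [AddCommGroup F] [Module k F]

theorem gradedComplex_d_apply (d : E →ₗ[k] E) (C : ℤ → Submodule k E) (hdd : ∀ x, d (d x) = 0)
    (hC : ∀ j, ∀ x ∈ C j, d x ∈ C (j + 1)) {i j : ℤ} (h : i + 1 = j) (x : C i) :
    (((gradedComplex d C hdd hC).d i j).hom x : C j).1 = d x.1 := by
  subst h
  simp [gradedComplex]
  rfl

/-- `π` is homotopic to the identity, through a homotopy that lowers the degree by one. -/
def IsHomotopicToId (d : E →ₗ[k] E) (C : ℤ → Submodule k E) (π : E →ₗ[k] E) : Prop :=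
  ∃ S : E →ₗ[k] E, (∀ j, ∀ x ∈ C j, S x ∈ C (j - 1)) ∧ ∀ x, π x = x - d (S x) - S (d x)

theorem isHomotopicToId_id (d : E →ₗ[k] E) (C : ℤ → Submodule k E) :
    IsHomotopicToId d C LinearMap.id :=
  ⟨0, fun _ _ _ => by simp, fun x => by simp⟩

namespace IsHomotopicToId

variable {d : E →ₗ[k] E} {C : ℤ → Submodule k E} {π π' : E →ₗ[k] E}

theorem commute (h : IsHomotopicToId d C π) (hdd : ∀ x, d (d x) = 0) (x : E) :
    π (d x) = d (π x) := by
  obtain ⟨S, -, hS⟩ := h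
  simp [hS, hdd]

theorem mem (h : IsHomotopicToId d C π) (hC : ∀ j, ∀ x ∈ C j, d x ∈ C (j + 1)) {j : ℤ} {x : E}
    (hx : x ∈ C j) : π x ∈ C j := by
  obtain ⟨S, hSC, hS⟩ := h
  rw [hS]
  refine sub_mem (sub_mem hx ?_) ?_
  · simpa using hC _ _ (hSC _ _ hx)
  · simpa using hSC _ _ (hC _ _ hx)

theorem comp (h' : IsHomotopicToId d C π') (h : IsHomotopicToId d C π)
    (hdd : ∀ x, d (d x) = 0) (hC : ∀ j, ∀ x ∈ C j, d x ∈ C (j + 1)) :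
    IsHomotopicToId d C (π' ∘ₗ π) := by
  have hc := h.commute hdd
  have hm := fun j x (hx : x ∈ C j) => h.mem hC hx
  obtain ⟨S, hSC, hS⟩ := h
  obtain ⟨S', hSC', hS'⟩ := h'
  -- Split `x - π' (π x)` as `(x - π x) + (π x - π' (π x))`; since `π` commutes with `d`, the second
  -- difference has the homotopy `S' ∘ π`.
  refine ⟨S + S' ∘ₗ π, fun j x hx => add_mem (hSC _ _ hx) (hSC' _ _ (hm _ _ hx)), fun x => ?_⟩
  simp only [LinearMap.comp_apply, LinearMap.add_apply, map_add, hc, hS' (π x)]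
  rw [hS x]
  simp only [map_sub, hdd]
  abel

end IsHomotopicToId

/-- An injective chain map of degree `-n`, whose image is that of a projection homotopic to the
identity, induces isomorphisms in homology. -/
theorem nonempty_gradedComplex_homology_equiv
    (d : E →ₗ[k] E) (C : ℤ → Submodule k E) (hdd : ∀ x, d (d x) = 0)
    (hC : ∀ j, ∀ x ∈ C j, d x ∈ C (j + 1))
    (d' : F →ₗ[k] F) (C' : ℤ → Submodule k F) (hdd' : ∀ x, d' (d' x) = 0)
    (hC' : ∀ j, ∀ x ∈ C' j, d' x ∈ C' (j + 1))
    (φ : F →ₗ[k] E) (hφ : Function.Injective φ) (hφd : ∀ f, d (φ f) = φ (d' f)) (n : ℤ)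
    (hφC : ∀ j, ∀ f ∈ C' j, φ f ∈ C (j - n))
    (π : E →ₗ[k] E) (hπ : IsHomotopicToId d C π) (hπφ : ∀ f, π (φ f) = φ f)
    (hπC : ∀ j, ∀ x ∈ C (j - n), ∃ f ∈ C' j, φ f = π x) (j j' : ℤ) (hj : j - n = j') :
    Nonempty ((gradedComplex d C hdd hC).homology j' ≃ₗ[k]
      (gradedComplex d' C' hdd' hC').homology j) := by
  subst hj
  have hcomm := hπ.commute hdd
  obtain ⟨S, hSC, hS⟩ := hπ
  let A := gradedComplex d' C' hdd' hC'
  let B := gradedComplex d C hdd hC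
  have eA : A.homology j ≃ₗ[k] (A.sc' (j - 1) j (j + 1)).homology :=
    (ShortComplex.homologyMapIso
      (A.isoSc' (j - 1) j (j + 1) (by simp) (by simp))).toLinearEquiv
  have eB : B.homology (j - n) ≃ₗ[k] (B.sc' (j - n - 1) (j - n) (j - n + 1)).homology :=
    (ShortComplex.homologyMapIso
      (B.isoSc' (j - n - 1) (j - n) (j - n + 1) (by simp) (by simp))).toLinearEquiv
  let φj : C' j →ₗ[k] C (j - n) := φ.restrict (hφC j)
  have hAg : ∀ x : C' j, (A.d j (j + 1)).hom x = 0 ↔ d' x.1 = 0 := fun x => by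
    rw [← gradedComplex_d_apply d' C' hdd' hC' rfl x]
    exact Subtype.ext_iff
  have hBg : ∀ x : C (j - n), (B.d (j - n) (j - n + 1)).hom x = 0 ↔ d x.1 = 0 := fun x => by
    rw [← gradedComplex_d_apply d C hdd hC rfl x]
    exact Subtype.ext_iff
  have hAf : ∀ x : C' j, (∃ y, (A.d (j - 1) j).hom y = x) ↔ ∃ y ∈ C' (j - 1), d' y = x.1 :=
    fun x => by
    constructor
    · rintro ⟨y, hy⟩
      refine ⟨y.1, y.2, ?_⟩
      rw [← gradedComplex_d_apply d' C' hdd' hC' (sub_add_cancel j 1) y]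
      exact congrArg Subtype.val hy
    · rintro ⟨y, hy, hyx⟩
      refine ⟨(⟨y, hy⟩ : C' (j - 1)), Subtype.ext ?_⟩
      rw [← hyx]
      exact gradedComplex_d_apply d' C' hdd' hC' (sub_add_cancel j 1) ⟨y, hy⟩
  have hBf : ∀ x : C (j - n), (∃ y, (B.d (j - n - 1) (j - n)).hom y = x) ↔
      ∃ y ∈ C (j - n - 1), d y = x.1 := fun x => by
    constructor
    · rintro ⟨y, hy⟩
      refine ⟨y.1, y.2, ?_⟩
      rw [← gradedComplex_d_apply d C hdd hC (sub_add_cancel (j - n) 1) y]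
      exact congrArg Subtype.val hy
    · rintro ⟨y, hy, hyx⟩
      refine ⟨(⟨y, hy⟩ : C (j - n - 1)), Subtype.ext ?_⟩
      rw [← hyx]
      exact gradedComplex_d_apply d C hdd hC (sub_add_cancel (j - n) 1) ⟨y, hy⟩
  obtain ⟨e⟩ := nonempty_homology_equiv (A.sc' (j - 1) j (j + 1))
    (B.sc' (j - n - 1) (j - n) (j - n + 1)) φj
    (fun x hx => by
      have h1 : d' x.1 = 0 := (hAg x).mp hx
      refine (hBg _).mpr ?_
      change d (φ x.1) = 0
      rw [hφd, h1, map_zero])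
    (fun x hx => by
      refine (hBf (φj x)).trans (Iff.trans ?_ (hAf x).symm)
      constructor
      · rintro ⟨y, hy, hyx⟩
        -- If `d y = φ x`, then `π y = φ f` satisfies `d (π y) = π (φ x) = φ x`, so `d' f = x` by
        -- injectivity of `φ`.
        obtain ⟨f, hf, hfy⟩ := hπC (j - 1) y (by rwa [sub_right_comm])
        refine ⟨f, hf, hφ ?_⟩
        rw [← hφd, hfy, ← hcomm, hyx]
        exact hπφ x.1
      · rintro ⟨y, hy, hyx⟩
        refine ⟨φ y, by rw [sub_right_comm]; exact hφC _ _ hy, ?_⟩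
        rw [hφd, hyx]
        rfl)
    (fun (z : C (j - n)) hz => by
      have hz' : d z.1 = 0 := (hBg z).mp hz
      obtain ⟨f, hf, hfz⟩ := hπC j z.1 z.2
      -- For a cycle `z` the homotopy formula reads `z - π z = d (S z)`.
      refine ⟨(⟨f, hf⟩ : C' j), (hAg _).mpr (hφ ?_), (hBf (z - φj ⟨f, hf⟩)).mpr
        ⟨S z.1, hSC _ _ z.2, ?_⟩⟩
      · rw [← hφd, hfz, ← hcomm, hz', map_zero, map_zero]
      · change d (S z.1) = z.1 - φ f
        rw [hfz, hS, hz', map_zero]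
        abel)
  exact ⟨eB ≪≫ₗ e.symm ≪≫ₗ eA.symm⟩

end Comparison

/-! ### Linear maps out of the Stanley–Reisner ring -/

section StanleyReisnerLift

variable {V : Type} (k : Type u) [Field k] (K : PreAbstractSimplicialComplex V)

/-- The exponent vector of the squarefree monomial with support `σ`. -/
def indicatorExp (σ : Finset V) : V →₀ ℕ := Finsupp.indicator σ fun _ _ => 1

theorem indicatorExp_apply [DecidableEq V] (σ : Finset V) (j : V) :
    indicatorExp σ j = if j ∈ σ then 1 else 0 := by
  rw [indicatorExp, Finsupp.indicator_apply]
  split_ifs <;> rfl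

theorem support_indicatorExp (σ : Finset V) : (indicatorExp σ).support = σ := by
  classical
  ext j
  simp [indicatorExp_apply]

theorem eq_indicatorExp_of_le_one {h : V →₀ ℕ} (hh : ∀ j, h j ≤ 1) :
    h = indicatorExp h.support := by
  classical
  ext j
  rw [indicatorExp_apply]
  have := hh j
  split_ifs with hj
  · have := Finsupp.mem_support_iff.mp hj
    omega
  · exact Finsupp.notMem_support_iff.mp hj

/-- Membership in a monomial ideal is tested on each monomial. The generator of a nonsimplex `τ`
divides `v^h` iff `τ ⊆ supp h`, and since `K` is closed under subsets such a `τ` exists iff `supp h`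
is itself a nonsimplex. -/
theorem mem_stanleyReisnerIdeal_iff (p : MvPolynomial V k) :
    p ∈ stanleyReisnerIdeal k K ↔ ∀ h ∈ p.support, h.support ∉ simplices K := by
  classical
  have hgen : {p : MvPolynomial V k | ∃ τ : Finset V, τ ∉ simplices K ∧
      p = ∏ j ∈ τ, MvPolynomial.X j} =
      Set.image (fun s => MvPolynomial.monomial s (1 : k))
        (Set.image indicatorExp {τ | τ ∉ simplices K}) := by
    have h1 : ∀ τ : Finset V, ∏ j ∈ τ, (MvPolynomial.X j : MvPolynomial V k) =
        MvPolynomial.monomial (indicatorExp τ) 1 := by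
      intro τ
      rw [MvPolynomial.monomial_eq, Finsupp.prod, support_indicatorExp, map_one, one_mul]
      refine Finset.prod_congr rfl fun j hj => ?_
      rw [indicatorExp_apply, if_pos hj, pow_one]
    ext p
    simp only [Set.mem_ofPred_eq, Set.image_image, Set.mem_image, h1]
    exact exists_congr fun τ => and_congr_right fun _ => eq_comm
  rw [stanleyReisnerIdeal, hgen, MvPolynomial.mem_ideal_span_monomial_image]
  refine forall₂_congr fun h _ => ?_
  constructor
  · rintro ⟨_, ⟨τ, hτ, rfl⟩, hle⟩ hh
    refine hτ (simplices_of_subset K hh fun j hj => ?_)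
    have := hle j
    rw [indicatorExp_apply, if_pos hj] at this
    exact Finsupp.mem_support_iff.mpr (by omega)
  · intro hh
    refine ⟨_, ⟨h.support, hh, rfl⟩, fun j => ?_⟩
    rw [indicatorExp_apply]
    split_ifs with hj
    · exact Nat.one_le_iff_ne_zero.mpr (Finsupp.mem_support_iff.mp hj)
    · exact Nat.zero_le _

variable {M : Type*} [AddCommGroup M] [Module k M]

/-- The linear map on `k(K)` with prescribed values on the monomials, those with support outside
`K` being sent to zero. -/
def srLift (F : (V →₀ ℕ) → M) (hF : ∀ h, h.support ∉ simplices K → F h = 0) :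
    StanleyReisnerRing k K →ₗ[k] M :=
  Submodule.liftQ ((stanleyReisnerIdeal k K).restrictScalars k)
    ((MvPolynomial.basisMonomials V k).constr k F) (by
      intro p hp
      rw [Submodule.restrictScalars_mem, mem_stanleyReisnerIdeal_iff] at hp
      rw [LinearMap.mem_ker, p.as_sum, map_sum]
      refine Finset.sum_eq_zero fun h hh => ?_
      have h1 : MvPolynomial.monomial h (p.coeff h) =
          p.coeff h • MvPolynomial.basisMonomials V k h := by
        rw [MvPolynomial.coe_basisMonomials, MvPolynomial.smul_monomial, smul_eq_mul, mul_one]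
      rw [h1, map_smul, Module.Basis.constr_basis, hF h (hp h hh), smul_zero])

theorem srLift_srMonomial (F : (V →₀ ℕ) → M) (hF : ∀ h, h.support ∉ simplices K → F h = 0)
    (h : V →₀ ℕ) : srLift k K F hF (srMonomial k K h) = F h := by
  have h1 := (MvPolynomial.basisMonomials V k).constr_basis k F h
  rw [MvPolynomial.coe_basisMonomials] at h1
  exact h1

theorem sr_induction {P : StanleyReisnerRing k K → Prop} (hmon : ∀ h, P (srMonomial k K h))
    (hadd : ∀ a b, P a → P b → P (a + b)) (hsmul : ∀ (c : k) a, P a → P (c • a))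
    (a : StanleyReisnerRing k K) : P a := by
  obtain ⟨p, rfl⟩ := Ideal.Quotient.mk_surjective a
  induction p using MvPolynomial.induction_on' with
  | monomial h c =>
    have h1 : Ideal.Quotient.mk (stanleyReisnerIdeal k K) (MvPolynomial.monomial h c) =
        c • srMonomial k K h := by
      rw [srMonomial, ← Ideal.Quotient.mkₐ_eq_mk k, ← map_smul, MvPolynomial.smul_monomial,
        smul_eq_mul, mul_one]
    rw [h1]
    exact hsmul _ _ (hmon h)
  | add p q hp hq =>
    rw [map_add]
    exact hadd _ _ hp hq

theorem mk_X_mul_srMonomial (j : V) (h : V →₀ ℕ) :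
    Ideal.Quotient.mk (stanleyReisnerIdeal k K) (MvPolynomial.X j) * srMonomial k K h =
      srMonomial k K (Finsupp.single j 1 + h) := by
  rw [srMonomial, srMonomial, ← map_mul, MvPolynomial.X, MvPolynomial.monomial_mul, one_mul]

end StanleyReisnerLift

/-! ### Monomials of the exterior algebra -/

section ExteriorMonomials

variable (k : Type u) [Field k] {r : ℕ}

theorem tGen_mul_self (i : Fin r) : tGen k i * tGen k i = 0 :=
  ExteriorAlgebra.ι_sq_zero _

theorem tGen_mul_comm (i j : Fin r) : tGen k i * tGen k j = -(tGen k j * tGen k i) :=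
  eq_neg_of_add_eq_zero_left (ExteriorAlgebra.ι_add_mul_swap _ _)

theorem tList_cons (i : Fin r) (l : List (Fin r)) : tList k (i :: l) = tGen k i * tList k l := by
  simp [tList]

/-- The scalar is a sign, left unspecified because its uses only concern vanishing and membership in
a span. -/
theorem tList_perm {l l' : List (Fin r)} (h : l.Perm l') : ∃ c : k, tList k l = c • tList k l' := by
  induction h with
  | nil => exact ⟨1, by simp⟩
  | cons a _ ih =>
    obtain ⟨c, hc⟩ := ih
    exact ⟨c, by rw [tList_cons, tList_cons, hc, mul_smul_comm]⟩
  | swap a b l =>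
    refine ⟨-1, ?_⟩
    simp only [tList_cons, ← mul_assoc]
    rw [tGen_mul_comm, neg_mul, neg_one_smul]
  | trans _ _ ih ih' =>
    obtain ⟨c, hc⟩ := ih
    obtain ⟨c', hc'⟩ := ih'
    exact ⟨c * c', by rw [hc, hc', smul_smul]⟩

theorem tGen_mul_tMonomial_of_mem {i : Fin r} {I : Finset (Fin r)} (hi : i ∈ I) :
    tGen k i * tMonomial k I = 0 := by
  have hi' : i ∈ I.sort (· ≤ ·) := by simpa using hi
  obtain ⟨c, hc⟩ := tList_perm k (List.perm_cons_erase hi')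
  rw [tMonomial, hc, mul_smul_comm, tList_cons, ← mul_assoc, tGen_mul_self, zero_mul, smul_zero]

theorem tGen_mul_tMonomial_of_notMem {i : Fin r} {I : Finset (Fin r)} (hi : i ∉ I) :
    ∃ c : k, tGen k i * tMonomial k I = c • tMonomial k (insert i I) := by
  rw [tMonomial, tMonomial, ← tList_cons]
  refine tList_perm k ?_
  rw [List.perm_ext_iff_of_nodup (List.nodup_cons.mpr ⟨by simpa using hi, Finset.sort_nodup _ _⟩)
    (Finset.sort_nodup _ _)]
  simp

/-- For `i ∈ I`, contract the relation `t_i t_I = 0` by the `i`-th coordinate. -/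
theorem tGen_mul_tContract_tMonomial (i : Fin r) (I : Finset (Fin r)) :
    tGen k i * tContract k i (tMonomial k I) = if i ∈ I then tMonomial k I else 0 := by
  split_ifs with hi
  · have h := tContract_tGen_mul k i i (tMonomial k I)
    rw [tGen_mul_tMonomial_of_mem k hi, map_zero, if_pos rfl, one_smul] at h
    exact (sub_eq_zero.mp h.symm).symm
  · rw [tContract_tMonomial_of_notMem k i I hi, mul_zero]

/-- Contractions strip off the generators one by one, up to sign, down to `1`. -/
theorem tMonomial_ne_zero (I : Finset (Fin r)) : tMonomial k I ≠ 0 := by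
  induction I using Finset.induction_on with
  | empty =>
    have h : tMonomial k (∅ : Finset (Fin r)) = 1 := by simp [tMonomial, tList]
    rw [h]
    exact one_ne_zero
  | insert i I hi ih =>
    intro h
    have h1 := tContract_tMonomial k i (insert i I) (Finset.mem_insert_self i I)
    rw [h, map_zero, Finset.erase_insert hi] at h1
    exact ih ((smul_eq_zero.mp h1.symm).resolve_left (pow_ne_zero _ (by simp)))

theorem idxOf_eq_length_filter_of_pairwise {β : Type*} [LinearOrder β] (l : List β)
    (hl : l.Pairwise (· < ·)) {i : β} (hi : i ∈ l) :
    l.idxOf i = (l.filter (· < i)).length := by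
  induction l with
  | nil => simp at hi
  | cons a l ih =>
    rw [List.pairwise_cons] at hl
    rcases eq_or_ne i a with rfl | hne
    · have h : l.filter (· < i) = [] := by
        rw [List.filter_eq_nil_iff]
        intro b hb
        simpa using (hl.1 b hb).le
      simp [h]
    · have hi' : i ∈ l := (List.mem_cons.mp hi).resolve_left hne
      rw [List.idxOf_cons_ne _ hne.symm, ih hl.2 hi', List.filter_cons_of_pos
        (by simpa using hl.1 i hi'), List.length_cons]

/-- Rewrites the sign of `tContract_tMonomial` as a count, comparable with `vertexSign`. -/
theorem idxOf_sort {β : Type*} [LinearOrder β] (I : Finset β) {i : β} (hi : i ∈ I) :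
    (I.sort (· ≤ ·)).idxOf i = (I.filter (· < i)).card := by
  rw [idxOf_eq_length_filter_of_pairwise _ (Finset.sortedLT_sort I).pairwise (by simpa using hi)]
  rw [← List.toFinset_card_of_nodup ((Finset.sort_nodup _ _).filter _), List.toFinset_filter,
    Finset.sort_toFinset]
  simp

end ExteriorMonomials

/-! ### The color of a vertex -/

namespace VertexPartition

variable {m r : ℕ} (α : VertexPartition m r)

/-- The index of the block that contains the vertex `j`. -/
def color (j : Fin m) : Fin r := (α.cover j).choose

theorem mem_block_iff {j : Fin m} {i : Fin r} : j ∈ α.block i ↔ α.color j = i := by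
  constructor
  · intro h
    by_contra hne
    exact Finset.disjoint_left.mp (α.disjoint _ _ hne) (α.cover j).choose_spec h
  · rintro rfl
    exact (α.cover j).choose_spec

theorem colors_eq_image (σ : Finset (Fin m)) : α.colors σ = σ.image α.color := by
  ext i
  simp [colors, Finset.Nonempty, mem_block_iff]

theorem mem_blockUnion_iff {L : Finset (Fin r)} {j : Fin m} :
    j ∈ α.blockUnion L ↔ α.color j ∈ L := by
  simp [blockUnion, mem_block_iff]

theorem IsNondegenerate.injOn_color {α : VertexPartition m r}
    {K : PreAbstractSimplicialComplex (Fin m)} (hα : α.IsNondegenerate K) {σ : Finset (Fin m)}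
    (hσ : σ ∈ simplices K) : Set.InjOn α.color σ := by
  intro a ha b hb hab
  by_contra hne
  have h : ({a, b} : Finset (Fin m)) ∈ simplices K := simplices_of_subset K hσ (by
    intro x hx
    rw [Finset.mem_insert, Finset.mem_singleton] at hx
    rcases hx with rfl | rfl
    exacts [ha, hb])
  rcases h with h | h
  · exact Finset.insert_ne_empty _ _ h
  · exact hα a b hne h (α.color b) ⟨α.mem_block_iff.mpr hab, α.mem_block_iff.mpr rfl⟩

end VertexPartition

/-! ### Division by the variables of one color -/

section Division

variable (k : Type u) [Field k] {m r : ℕ} (K : PreAbstractSimplicialComplex (Fin m))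
  (α : VertexPartition m r)

/-- The threshold `2` in `divColor` serves to keep the support, and with it the colors, unchanged.
-/
theorem support_sub_single {V : Type} {h : V →₀ ℕ} {j : V} (hj : 2 ≤ h j) :
    (h - Finsupp.single j 1).support = h.support := by
  classical
  ext x
  rw [Finsupp.mem_support_iff, Finsupp.mem_support_iff, Finsupp.tsub_apply, Finsupp.single_apply]
  split_ifs with hx
  · subst hx
    omega
  · simp

theorem support_single_add {V : Type} [DecidableEq V] (h : V →₀ ℕ) (j : V) :
    (Finsupp.single j 1 + h).support = insert j h.support := by
  ext x
  rcases eq_or_ne x j with rfl | hx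
  · simp
  · simp [hx]

/-- The linear map that divides by `v_j`, for `j` in the block `i`, the monomials divisible by
`v_j ^ 2`, and annihilates the monomials without such a `j`. -/
def divColor (i : Fin r) : StanleyReisnerRing k K →ₗ[k] StanleyReisnerRing k K :=
  srLift k K (fun h => ∑ j ∈ α.block i,
    if 2 ≤ h j then srMonomial k K (h - Finsupp.single j 1) else 0) fun h hh =>
      Finset.sum_eq_zero fun j _ => by
        split_ifs with hj
        · exact srMonomial_eq_zero k K _ (by rwa [support_sub_single hj])
        · rfl

theorem divColor_srMonomial (i : Fin r) (h : Fin m →₀ ℕ) :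
    divColor k K α i (srMonomial k K h) = ∑ j ∈ α.block i,
      if 2 ≤ h j then srMonomial k K (h - Finsupp.single j 1) else 0 :=
  srLift_srMonomial k K _ _ h

theorem paramHom_X_mul_srMonomial (i : Fin r) (h : Fin m →₀ ℕ) :
    paramHom k K α (MvPolynomial.X i) * srMonomial k K h =
      ∑ j ∈ α.block i, srMonomial k K (Finsupp.single j 1 + h) := by
  simp only [paramHom, MvPolynomial.aeval_X, Finset.sum_mul, mk_X_mul_srMonomial]

/-- `divColor` in color `i` looks only at exponents in the block `i`, while `u_l` changes only
exponents in the block `l`. -/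
theorem divColor_paramHom_X_mul {i l : Fin r} (hil : l ≠ i) (a : StanleyReisnerRing k K) :
    divColor k K α i (paramHom k K α (MvPolynomial.X l) * a) =
      paramHom k K α (MvPolynomial.X l) * divColor k K α i a := by
  induction a using sr_induction k K with
  | hadd a b ha hb => rw [mul_add, map_add, ha, hb, map_add, mul_add]
  | hsmul c a ha => rw [mul_smul_comm, map_smul, ha, map_smul, mul_smul_comm]
  | hmon h =>
    rw [paramHom_X_mul_srMonomial, map_sum, divColor_srMonomial, Finset.mul_sum]
    simp only [divColor_srMonomial]
    rw [Finset.sum_comm]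
    refine Finset.sum_congr rfl fun j hj => ?_
    have hne : ∀ j' ∈ α.block l, j' ≠ j := by
      rintro j' hj' rfl
      exact hil ((α.mem_block_iff.mp hj').symm.trans (α.mem_block_iff.mp hj))
    by_cases h2 : 2 ≤ h j
    · rw [if_pos h2, paramHom_X_mul_srMonomial]
      refine Finset.sum_congr rfl fun j' hj' => ?_
      have h0 := hne j' hj'
      have h3 : (Finsupp.single j' 1 + h : Fin m →₀ ℕ) j = h j := by simp [h0.symm]
      rw [if_pos (by rwa [h3])]
      congr 1
      rw [add_tsub_assoc_of_le]
      rw [Finsupp.single_le_iff]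
      omega
    · rw [if_neg h2, mul_zero]
      refine Finset.sum_eq_zero fun j' hj' => ?_
      have h0 := hne j' hj'
      have h3 : (Finsupp.single j' 1 + h : Fin m →₀ ℕ) j = h j := by simp [h0.symm]
      rw [if_neg (by rwa [h3])]

variable {K α}

/-- Any other vertex of the color of `j` would give a support with two vertices of one color, hence
a nonsimplex, so its term vanishes. -/
theorem paramHom_X_mul_srMonomial_of_mem (hα : α.IsNondegenerate K) {h : Fin m →₀ ℕ}
    {j : Fin m} (hj : j ∈ h.support) :
    paramHom k K α (MvPolynomial.X (α.color j)) * srMonomial k K h =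
      srMonomial k K (Finsupp.single j 1 + h) := by
  rw [paramHom_X_mul_srMonomial]
  refine Finset.sum_eq_single_of_mem j (α.mem_block_iff.mpr rfl) fun j' hj' hne => ?_
  refine srMonomial_eq_zero k K _ fun hs => hne ?_
  rw [support_single_add] at hs
  exact hα.injOn_color hs (by simp) (by simpa using Or.inr (Finsupp.mem_support_iff.mp hj))
    (α.mem_block_iff.mp hj')

theorem divColor_srMonomial_of_mem (hα : α.IsNondegenerate K) {h : Fin m →₀ ℕ}
    (hh : h.support ∈ simplices K) {j : Fin m}
    (hj : j ∈ h.support) :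
    divColor k K α (α.color j) (srMonomial k K h) =
      if 2 ≤ h j then srMonomial k K (h - Finsupp.single j 1) else 0 := by
  rw [divColor_srMonomial]
  refine Finset.sum_eq_single_of_mem j (α.mem_block_iff.mpr rfl) fun j' hj' hne => ?_
  refine if_neg fun h2 => hne ?_
  exact hα.injOn_color hh (Finset.mem_coe.mpr (Finsupp.mem_support_iff.mpr (by omega)))
    (Finset.mem_coe.mpr hj) (α.mem_block_iff.mp hj')

theorem paramHom_X_mul_divColor_srMonomial (hα : α.IsNondegenerate K) {h : Fin m →₀ ℕ}
    (hh : h.support ∈ simplices K)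
    (i : Fin r) [Decidable (∃ j ∈ α.block i, 2 ≤ h j)] :
    paramHom k K α (MvPolynomial.X i) * divColor k K α i (srMonomial k K h) =
      if ∃ j ∈ α.block i, 2 ≤ h j then srMonomial k K h else 0 := by
  split_ifs with hex
  · obtain ⟨j, hj, h2⟩ := hex
    obtain rfl := α.mem_block_iff.mp hj
    rw [divColor_srMonomial_of_mem k hα hh (Finsupp.mem_support_iff.mpr (by omega)), if_pos h2,
      paramHom_X_mul_srMonomial_of_mem k hα (by
        rw [support_sub_single h2]; exact Finsupp.mem_support_iff.mpr (by omega)),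
      add_tsub_cancel_of_le]
    rw [Finsupp.single_le_iff]
    omega
  · rw [divColor_srMonomial, Finset.sum_eq_zero, mul_zero]
    exact fun j hj => if_neg fun h2 => hex ⟨j, hj, h2⟩

theorem divColor_paramHom_X_mul_srMonomial (hα : α.IsNondegenerate K) {h : Fin m →₀ ℕ}
    (hh : h.support ∈ simplices K)
    (i : Fin r) :
    divColor k K α i (paramHom k K α (MvPolynomial.X i) * srMonomial k K h) =
      if i ∈ α.colors h.support then srMonomial k K h else 0 := by
  split_ifs with hi
  · rw [α.colors_eq_image, Finset.mem_image] at hi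
    obtain ⟨j, hj, rfl⟩ := hi
    have hs : (Finsupp.single j 1 + h).support = h.support := by
      rw [support_single_add, Finset.insert_eq_of_mem hj]
    have h0 := Finsupp.mem_support_iff.mp hj
    rw [paramHom_X_mul_srMonomial_of_mem k hα hj,
      divColor_srMonomial_of_mem k hα (by rwa [hs]) (by rwa [hs]),
      if_pos (by simp only [Finsupp.add_apply, Finsupp.single_eq_same]; omega),
      add_tsub_cancel_left]
  · rw [paramHom_X_mul_srMonomial, map_sum]
    refine Finset.sum_eq_zero fun j hj => ?_
    rw [divColor_srMonomial]
    refine Finset.sum_eq_zero fun j' hj' => if_neg ?_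
    -- If color `i` is absent from `supp h`, the terms of `u_i v^h` have exponent at most `1` in
    -- that color, below the threshold of `divColor`.
    have h0 : h j' = 0 := by
      by_contra h0
      refine hi ?_
      rw [α.colors_eq_image, Finset.mem_image]
      exact ⟨j', Finsupp.mem_support_iff.mpr h0, α.mem_block_iff.mp hj'⟩
    rw [Finsupp.add_apply, h0, Finsupp.single_apply]
    split_ifs <;> omega

end Division

/-! ### The contraction of the Koszul complex onto its squarefree part -/

section Contraction

variable (k : Type u) [Field k] {m r : ℕ} (K : PreAbstractSimplicialComplex (Fin m))
  (α : VertexPartition m r)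

/-- The homotopy `t_i ⊗ divColor i`. -/
def colorHomotopy (i : Fin r) : Koszul k K r →ₗ[k] Koszul k K r :=
  TensorProduct.map (LinearMap.mulLeft k (tGen k i)) (divColor k K α i)

theorem colorHomotopy_tmul (i : Fin r) (x : Ext k r) (a : StanleyReisnerRing k K) :
    colorHomotopy k K α i (x ⊗ₜ a) = (tGen k i * x) ⊗ₜ divColor k K α i a := rfl

/-- For `l ≠ i` the contraction by `l` anticommutes with `t_i` while `u_l` commutes with `divColor`,
so the cross terms cancel and only `l = i` remains. -/
theorem koszulD_colorHomotopy_add (i : Fin r) (x : Ext k r) (a : StanleyReisnerRing k K) :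
    koszulD k K α (colorHomotopy k K α i (x ⊗ₜ a)) +
      colorHomotopy k K α i (koszulD k K α (x ⊗ₜ a)) =
    (x - tGen k i * tContract k i x) ⊗ₜ
        (paramHom k K α (MvPolynomial.X i) * divColor k K α i a) +
      (tGen k i * tContract k i x) ⊗ₜ
        divColor k K α i (paramHom k K α (MvPolynomial.X i) * a) := by
  rw [colorHomotopy_tmul, koszulD_tmul, koszulD_tmul, map_sum, ← Finset.sum_add_distrib]
  simp only [colorHomotopy_tmul]
  rw [Finset.sum_eq_single_of_mem i (Finset.mem_univ i)]
  · rw [tContract_tGen_mul, if_pos rfl, one_smul]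
  · intro l _ hl
    rw [divColor_paramHom_X_mul k K α hl, ← TensorProduct.add_tmul, tContract_tGen_mul,
      if_neg hl, zero_smul, zero_sub, neg_add_cancel, TensorProduct.zero_tmul]

theorem colorHomotopy_mem_koszulPiece (i : Fin r) (L : Finset (Fin r)) (j : ℤ) (x : Koszul k K r)
    (hx : x ∈ koszulPiece k K α L j) : colorHomotopy k K α i x ∈ koszulPiece k K α L (j - 1) := by
  induction hx using Submodule.span_induction with
  | zero => simp
  | add x y _ _ hx hy => rw [map_add]; exact add_mem hx hy
  | smul c x _ hx => rw [map_smul]; exact Submodule.smul_mem _ _ hx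
  | mem x hx =>
    obtain ⟨I, h, hh, hL, hI, rfl⟩ := hx
    rw [colorHomotopy_tmul]
    by_cases hi : i ∈ I
    · rw [tGen_mul_tMonomial_of_mem k hi, TensorProduct.zero_tmul]
      exact zero_mem _
    obtain ⟨c, hc⟩ := tGen_mul_tMonomial_of_notMem k hi
    rw [hc, ← TensorProduct.smul_tmul', divColor_srMonomial, TensorProduct.tmul_sum]
    refine Submodule.smul_mem _ _ (Submodule.sum_mem _ fun v hv => ?_)
    split_ifs with h2
    · refine Submodule.subset_span ⟨insert i I, _, ?_, ?_, ?_, rfl⟩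
      · rwa [support_sub_single h2]
      -- The color `i` added to `I` already belongs to `L`, being the color of `v ∈ supp h`.
      · rw [support_sub_single h2, Finset.union_insert, hL, Finset.insert_eq_of_mem]
        rw [← hL, α.colors_eq_image]
        refine Finset.mem_union_left _ (Finset.mem_image.mpr ⟨v, ?_, α.mem_block_iff.mp hv⟩)
        exact Finsupp.mem_support_iff.mpr (by omega)
      · rw [Finset.card_insert_of_notMem hi]
        push_cast
        omega
    · rw [TensorProduct.tmul_zero]
      exact zero_mem _

/-- The condition on `t_I v^h` to survive the contraction in color `i`. -/
def IsReducedAt (i : Fin r) (I : Finset (Fin r)) (h : Fin m →₀ ℕ) : Prop :=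
  (∀ j ∈ α.block i, h j ≤ 1) ∧ (i ∈ I → i ∉ α.colors h.support)

variable {K α}

open Classical in
theorem exists_isHomotopicToId_color (hα : α.IsNondegenerate K) (L : Finset (Fin r)) (i : Fin r) :
    ∃ p, IsHomotopicToId (koszulD k K α) (koszulPiece k K α L) p ∧
      ∀ I h, h.support ∈ simplices K → p (tMonomial k I ⊗ₜ srMonomial k K h) =
        if IsReducedAt α i I h then tMonomial k I ⊗ₜ srMonomial k K h else 0 := by
  refine ⟨LinearMap.id - koszulD k K α ∘ₗ colorHomotopy k K α i -
    colorHomotopy k K α i ∘ₗ koszulD k K α,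
    ⟨_, colorHomotopy_mem_koszulPiece k K α i L, fun x => rfl⟩, fun I h hh => ?_⟩
  simp only [LinearMap.sub_apply, LinearMap.comp_apply, LinearMap.id_apply]
  rw [sub_sub, koszulD_colorHomotopy_add, paramHom_X_mul_divColor_srMonomial k hα hh,
    divColor_paramHom_X_mul_srMonomial k hα hh, tGen_mul_tContract_tMonomial]
  -- A square of color `i` makes the color occur, so such a monomial is removed whether or not `i ∈
  -- I`.
  have hcol : (∃ j ∈ α.block i, 2 ≤ h j) → i ∈ α.colors h.support := by
    rintro ⟨j, hj, h2⟩
    rw [α.colors_eq_image]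
    exact Finset.mem_image.mpr ⟨j, Finsupp.mem_support_iff.mpr (by omega), α.mem_block_iff.mp hj⟩
  have hle : (∀ j ∈ α.block i, h j ≤ 1) ↔ ¬ ∃ j ∈ α.block i, 2 ≤ h j := by
    push Not
    exact forall₂_congr fun j _ => by omega
  rw [IsReducedAt, hle]
  clear hle
  by_cases h2 : ∃ j ∈ α.block i, 2 ≤ h j
  · have hn : ¬(¬(∃ j ∈ α.block i, 2 ≤ h j) ∧ (i ∈ I → i ∉ α.colors h.support)) :=
      fun hr => hr.1 h2
    rw [if_pos h2, if_neg hn, if_pos (hcol h2), ← TensorProduct.add_tmul, sub_add_cancel, sub_self]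
  · rw [if_neg h2, TensorProduct.tmul_zero, zero_add]
    simp only [h2, not_false_eq_true, true_and]
    by_cases hI : i ∈ I <;> by_cases hc : i ∈ α.colors h.support <;> simp [hI, hc]

open Classical in
-- The projections for the single colors are diagonal on the monomials, so composing them
-- accumulates their conditions.
theorem exists_isHomotopicToId (hα : α.IsNondegenerate K) (L : Finset (Fin r))
    (s : Finset (Fin r)) :
    ∃ p, IsHomotopicToId (koszulD k K α) (koszulPiece k K α L) p ∧
      ∀ I h, h.support ∈ simplices K → p (tMonomial k I ⊗ₜ srMonomial k K h) =
        if ∀ i ∈ s, IsReducedAt α i I h then tMonomial k I ⊗ₜ srMonomial k K h else 0 := by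
  induction s using Finset.induction_on with
  | empty => exact ⟨_, isHomotopicToId_id _ _, fun I h _ => by simp⟩
  | insert i s _ ih =>
    obtain ⟨p, hp, hp'⟩ := ih
    obtain ⟨p₁, hp₁, hp₁'⟩ := exists_isHomotopicToId_color k hα L i
    refine ⟨_, hp₁.comp hp (koszulD_koszulD k K α) (koszulD_mem_koszulPiece k K α L),
      fun I h hh => ?_⟩
    rw [LinearMap.comp_apply, hp' I h hh, apply_ite p₁, map_zero, hp₁' I h hh]
    simp only [Finset.forall_mem_insert]
    by_cases h1 : IsReducedAt α i I h <;> by_cases h2 : ∀ i ∈ s, IsReducedAt α i I h <;>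
      simp [h1, h2]

end Contraction

/-! ### The signs that compare the orders of vertices and of colors -/

section Sign

variable {V W : Type*} [LinearOrder V] [LinearOrder W]

/-- The sum over `x ∈ σ` of the position of the color `c x` in `L`, plus the number of inversions
of `c` on `σ`. -/
def orientationExponent (c : V → W) (L : Finset W) (σ : Finset V) : ℕ :=
  ∑ x ∈ σ, (L.filter (· < c x)).card + ∑ x ∈ σ, (σ.filter fun y => x < y ∧ c y < c x).card

theorem orientationExponent_insert (c : V → W) (L : Finset W) {σ : Finset V} {v : V}
    (hv : v ∉ σ) :
    orientationExponent c L (insert v σ) = orientationExponent c L σ + (L.filter (· < c v)).card +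
      (σ.filter fun y => v < y ∧ c y < c v).card + (σ.filter fun x => x < v ∧ c v < c x).card := by
  have h1 : ((insert v σ).filter fun y => v < y ∧ c y < c v) =
      σ.filter fun y => v < y ∧ c y < c v := by
    rw [Finset.filter_insert, if_neg (by simp)]
  have h2 : ∀ x ∈ σ, ((insert v σ).filter fun y => x < y ∧ c y < c x).card =
      (σ.filter fun y => x < y ∧ c y < c x).card + if x < v ∧ c v < c x then 1 else 0 := by
    intro x _
    rw [Finset.filter_insert]
    split_ifs
    · rw [Finset.card_insert_of_notMem (by simp [hv])]
    · rfl
  rw [orientationExponent, orientationExponent, Finset.sum_insert hv, Finset.sum_insert hv, h1,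
    Finset.sum_congr rfl h2, Finset.sum_add_distrib,
    Finset.card_filter (fun x => x < v ∧ c v < c x)]
  ring

/-- The elements of `σ` are classified by their order relative to `v` and by the order of their
colors relative to `c v`; in the exponents each class that matters is counted an even number of
times. -/
theorem neg_one_pow_orientationExponent {R : Type*} [CommRing R] (c : V → W) {L : Finset W}
    {σ : Finset V} {v : V} (hv : v ∉ σ) (hc : Set.InjOn c (insert v σ : Finset V))
    (hL : σ.image c ⊆ L) :
    (-1 : R) ^ orientationExponent c L σ * (-1) ^ ((L \ σ.image c).filter (· < c v)).card =
      (-1) ^ (σ.filter (· < v)).card * (-1) ^ orientationExponent c L (insert v σ) := by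
  have hne : ∀ x ∈ σ, c x ≠ c v := fun x hx h =>
    hv (hc (by simp [hx]) (by simp) h ▸ hx)
  have hne' : ∀ x ∈ σ, x ≠ v := fun x hx h => hv (h ▸ hx)
  have hcσ : Set.InjOn c σ := hc.mono (by simp)
  have hP : (σ.filter (· < v)).card = (σ.filter fun x => x < v ∧ c x < c v).card +
      (σ.filter fun x => x < v ∧ c v < c x).card := by
    rw [← Finset.card_union_of_disjoint]
    · congr 1
      ext x
      simp only [Finset.mem_filter, Finset.mem_union]
      have := fun hx => lt_or_gt_of_ne (hne x hx)
      tauto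
    · rw [Finset.disjoint_filter]
      exact fun x _ h h' => lt_asymm h.2 h'.2
  have hQ : (σ.filter fun x => c x < c v).card = (σ.filter fun x => x < v ∧ c x < c v).card +
      (σ.filter fun y => v < y ∧ c y < c v).card := by
    rw [← Finset.card_union_of_disjoint]
    · congr 1
      ext x
      simp only [Finset.mem_filter, Finset.mem_union]
      have := fun hx => lt_or_gt_of_ne (hne' x hx)
      tauto
    · rw [Finset.disjoint_filter]
      exact fun x _ h h' => lt_asymm h.1 h'.1
  have hA : (L.filter (· < c v)).card = ((L \ σ.image c).filter (· < c v)).card +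
      (σ.filter fun x => c x < c v).card := by
    have h1 : ((σ.image c).filter (· < c v)).card = (σ.filter fun x => c x < c v).card := by
      rw [Finset.filter_image, Finset.card_image_of_injOn
        (hcσ.mono (Finset.coe_subset.mpr (Finset.filter_subset _ _)))]
    rw [← h1, ← Finset.card_union_of_disjoint]
    · rw [← Finset.filter_union, Finset.sdiff_union_of_subset hL]
    · exact Finset.disjoint_filter_filter Finset.sdiff_disjoint
  have key : (σ.filter (· < v)).card + orientationExponent c L (insert v σ) =
      orientationExponent c L σ + ((L \ σ.image c).filter (· < c v)).card +
        2 * ((σ.filter fun x => x < v ∧ c x < c v).card +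
          (σ.filter fun x => x < v ∧ c v < c x).card +
          (σ.filter fun y => v < y ∧ c y < c v).card) := by
    rw [orientationExponent_insert c L hv, hP, hA, hQ]
    ring
  rw [← pow_add, ← pow_add, key, pow_add _ _ (2 * _), pow_mul]
  simp

theorem vertexSign_insert {V : Type} [LinearOrder V] (k : Type u) [Field k] (v : V)
    (σ : Finset V) : vertexSign k v (insert v σ) = (-1) ^ (σ.filter (· < v)).card := by
  rw [vertexSign, Finset.filter_insert, if_neg (lt_irrefl v)]

end Sign

/-! ### The embedding of the simplicial cochains into the Koszul complex -/

section Embedding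

variable (k : Type u) [Field k] {m r : ℕ} (K : PreAbstractSimplicialComplex (Fin m))
  (α : VertexPartition m r) (L : Finset (Fin r))

theorem colors_subset_of_subset_blockUnion {α : VertexPartition m r} {L : Finset (Fin r)}
    {σ : Finset (Fin m)} (hσω : σ ⊆ α.blockUnion L) : α.colors σ ⊆ L := by
  rw [α.colors_eq_image]
  intro i hi
  obtain ⟨x, hx, rfl⟩ := Finset.mem_image.mp hi
  exact α.mem_blockUnion_iff.mp (hσω hx)

theorem card_sdiff_colors {K : PreAbstractSimplicialComplex (Fin m)} {α : VertexPartition m r}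
    (hα : α.IsNondegenerate K) {L : Finset (Fin r)} {σ : Finset (Fin m)} (hσ : σ ∈ simplices K)
    (hσω : σ ⊆ α.blockUnion L) : ((L \ α.colors σ).card : ℤ) = L.card - σ.card := by
  rw [Finset.cast_card_sdiff (colors_subset_of_subset_blockUnion hσω), α.colors_eq_image,
    Finset.card_image_of_injOn (hα.injOn_color hσ)]

/-- The signed element `± t_{L ∖ I_α(σ)} v_σ` of the Koszul complex. -/
def simplexElement (σ : Finset (Fin m)) : Koszul k K r :=
  (-1 : k) ^ orientationExponent α.color L σ •
    tMonomial k (L \ α.colors σ) ⊗ₜ srMonomial k K (indicatorExp σ)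

theorem simplexElement_eq_zero {σ : Finset (Fin m)} (hσ : σ ∉ simplices K) :
    simplexElement k K α L σ = 0 := by
  rw [simplexElement, srMonomial_eq_zero, TensorProduct.tmul_zero, smul_zero]
  rwa [support_indicatorExp]

theorem mem_simplices_fullSubcomplex {V : Type} {K : PreAbstractSimplicialComplex V}
    {ω σ : Finset V} : σ ∈ simplices (fullSubcomplex K ω) ↔ σ ∈ simplices K ∧ σ ⊆ ω := by
  constructor
  · rintro (rfl | h)
    · exact ⟨Or.inl rfl, Finset.empty_subset _⟩
    · exact ⟨Or.inr h.1, h.2⟩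
  · rintro ⟨rfl | h, h'⟩
    · exact Or.inl rfl
    · exact Or.inr ⟨h, h'⟩

theorem single_add_indicatorExp {V : Type} [DecidableEq V] {σ : Finset V} {v : V} (hv : v ∉ σ) :
    Finsupp.single v 1 + indicatorExp σ = indicatorExp (insert v σ) := by
  ext x
  rw [Finsupp.add_apply, indicatorExp_apply, indicatorExp_apply, Finsupp.single_apply]
  rcases eq_or_ne v x with rfl | hx
  · simp [hv]
  · simp [hx, hx.symm]

/-- Vertices outside `ω_L` or in `σ` have a color missing from `L ∖ I_α(σ)`, so their contraction is
zero. A remaining `v` either gives a simplex, hence a new color and the sign identity, or makes both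
terms vanish. -/
theorem koszulD_simplexElement (hα : α.IsNondegenerate K) {σ : Finset (Fin m)}
    (hσω : σ ⊆ α.blockUnion L) :
    koszulD k K α (simplexElement k K α L σ) = ∑ v ∈ α.blockUnion L \ σ,
      vertexSign k v (insert v σ) • simplexElement k K α L (insert v σ) := by
  have hσL : σ.image α.color ⊆ L :=
    α.colors_eq_image σ ▸ colors_subset_of_subset_blockUnion hσω
  have h1 : koszulD k K α (tMonomial k (L \ α.colors σ) ⊗ₜ srMonomial k K (indicatorExp σ)) =
      ∑ v, tContract k (α.color v) (tMonomial k (L \ α.colors σ)) ⊗ₜ[k]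
        srMonomial k K (Finsupp.single v 1 + indicatorExp σ) := by
    rw [koszulD_tmul, ← Finset.sum_fiberwise Finset.univ α.color]
    refine Finset.sum_congr rfl fun i _ => ?_
    rw [paramHom_X_mul_srMonomial, TensorProduct.tmul_sum]
    have h2 : α.block i = Finset.univ.filter fun v => α.color v = i := by
      ext v
      simp [α.mem_block_iff]
    rw [h2]
    refine Finset.sum_congr rfl fun v hv => ?_
    rw [(Finset.mem_filter.mp hv).2]
  rw [simplexElement, map_smul, h1, Finset.smul_sum]
  symm
  refine Finset.sum_subset_zero_on_sdiff (Finset.subset_univ _) ?_ ?_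
  · intro v hv
    rw [tContract_tMonomial_of_notMem, TensorProduct.zero_tmul, smul_zero]
    intro hvL
    rw [α.colors_eq_image, Finset.mem_sdiff] at hvL
    simp only [Finset.mem_sdiff, Finset.mem_univ, true_and, α.mem_blockUnion_iff, not_and,
      not_not] at hv
    exact hvL.2 (Finset.mem_image_of_mem _ (hv hvL.1))
  · intro v hv
    rw [Finset.mem_sdiff, α.mem_blockUnion_iff] at hv
    rw [single_add_indicatorExp hv.2]
    by_cases hs : insert v σ ∈ simplices K
    · have hinj := hα.injOn_color hs
      have hvc : α.color v ∈ L \ α.colors σ := by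
        rw [Finset.mem_sdiff, α.colors_eq_image, Finset.mem_image]
        refine ⟨hv.1, ?_⟩
        rintro ⟨x, hx, hxv⟩
        exact hv.2 (hinj (by simp [hx]) (by simp) hxv ▸ hx)
      have herase : (L \ α.colors σ).erase (α.color v) = L \ α.colors (insert v σ) := by
        rw [α.colors_eq_image, α.colors_eq_image, Finset.image_insert, Finset.sdiff_insert]
      rw [tContract_tMonomial k _ _ hvc, idxOf_sort _ hvc, herase, simplexElement,
        ← TensorProduct.smul_tmul', smul_smul, smul_smul, vertexSign_insert, α.colors_eq_image σ,
        neg_one_pow_orientationExponent α.color hv.2 hinj hσL]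
    · rw [simplexElement_eq_zero k K α L hs, srMonomial_eq_zero, TensorProduct.tmul_zero,
        smul_zero, smul_zero]
      rwa [support_indicatorExp]

open Classical in
/-- The embedding of the simplicial cochains of the full subcomplex on `ω_L` into the Koszul
complex. -/
def cochainEmbedding :
    (simplices (fullSubcomplex K (α.blockUnion L)) → k) →ₗ[k] Koszul k K r :=
  ∑ σ, (LinearMap.proj σ).smulRight (simplexElement k K α L σ.1)

open Classical in
theorem cochainEmbedding_apply (f : simplices (fullSubcomplex K (α.blockUnion L)) → k) :
    cochainEmbedding k K α L f = ∑ σ, f σ • simplexElement k K α L σ.1 := by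
  simp [cochainEmbedding]

theorem cochainEmbedding_single [DecidableEq (simplices (fullSubcomplex K (α.blockUnion L)))]
    (σ : simplices (fullSubcomplex K (α.blockUnion L))) (c : k) :
    cochainEmbedding k K α L (Pi.single σ c) = c • simplexElement k K α L σ.1 := by
  classical
  rw [cochainEmbedding_apply, Finset.sum_eq_single_of_mem σ (Finset.mem_univ σ)]
  · rw [Pi.single_eq_same]
  · intro τ _ hτ
    rw [Pi.single_eq_of_ne hτ, zero_smul]

theorem koszulD_cochainEmbedding (hα : α.IsNondegenerate K)
    (f : simplices (fullSubcomplex K (α.blockUnion L)) → k) :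
    koszulD k K α (cochainEmbedding k K α L f) =
      cochainEmbedding k K α L (coboundary k _ f) := by
  classical
  rw [cochainEmbedding_apply, cochainEmbedding_apply, map_sum]
  have h1 : ∀ σ : simplices (fullSubcomplex K (α.blockUnion L)),
      koszulD k K α (f σ • simplexElement k K α L σ.1) =
        ∑ v ∈ (α.blockUnion L \ σ.1).filter fun v => insert v σ.1 ∈ simplices K,
          (f σ * vertexSign k v (insert v σ.1)) • simplexElement k K α L (insert v σ.1) := by
    intro σ
    rw [map_smul, koszulD_simplexElement k K α L hα (mem_simplices_fullSubcomplex.mp σ.2).2,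
      Finset.smul_sum, Finset.sum_filter_of_ne]
    · exact Finset.sum_congr rfl fun v _ => smul_smul _ _ _
    · intro v _ hne
      by_contra hs
      exact hne (by rw [simplexElement_eq_zero k K α L hs, smul_zero])
  have h2 : ∀ τ : simplices (fullSubcomplex K (α.blockUnion L)),
      coboundary k _ f τ • simplexElement k K α L τ.1 = ∑ v ∈ τ.1,
        (vertexSign k v τ.1 * f ⟨τ.1.erase v, simplices_of_subset _ τ.2
          (Finset.erase_subset v τ.1)⟩) • simplexElement k K α L τ.1 := fun τ =>
    Finset.sum_smul
  rw [Finset.sum_congr rfl fun σ _ => h1 σ, Finset.sum_congr rfl fun τ _ => h2 τ,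
    Finset.sum_sigma', Finset.sum_sigma']
  -- Both sums run over pairs of a simplex and a codimension-one face: `(σ, v)` corresponds to `(σ ∪
  -- {v}, v)`.
  refine Finset.sum_bij'
    (fun p hp => ⟨⟨insert p.2 p.1.1, ?_⟩, p.2⟩)
    (fun p _ => ⟨⟨p.1.1.erase p.2, simplices_of_subset _ p.1.2 (Finset.erase_subset _ _)⟩, p.2⟩)
    ?_ ?_ ?_ ?_ ?_
  · simp only [Finset.mem_sigma, Finset.mem_filter, Finset.mem_sdiff] at hp
    exact mem_simplices_fullSubcomplex.mpr ⟨hp.2.2, Finset.insert_subset hp.2.1.1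
      (mem_simplices_fullSubcomplex.mp p.1.2).2⟩
  · intro p hp
    simp
  · intro p hp
    simp only [Finset.mem_sigma, Finset.mem_univ, true_and] at hp
    have h3 := mem_simplices_fullSubcomplex.mp p.1.2
    simp only [Finset.mem_sigma, Finset.mem_filter, Finset.mem_sdiff, Finset.mem_univ, true_and,
      Finset.insert_erase hp]
    exact ⟨⟨h3.2 hp, Finset.notMem_erase _ _⟩, h3.1⟩
  · rintro ⟨⟨σ, hσ⟩, v⟩ hp
    simp only [Finset.mem_sigma, Finset.mem_filter, Finset.mem_sdiff] at hp
    simp [Finset.erase_insert hp.2.1.2]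
  · rintro ⟨⟨τ, hτ⟩, v⟩ hp
    simp only [Finset.mem_sigma, Finset.mem_univ, true_and] at hp
    simp [Finset.insert_erase hp]
  · rintro ⟨⟨σ, hσ⟩, v⟩ hp
    simp only [Finset.mem_sigma, Finset.mem_filter, Finset.mem_sdiff] at hp
    simp [Finset.erase_insert hp.2.1.2, mul_comm]

theorem cochainEmbedding_injective : Function.Injective (cochainEmbedding k K α L) := by
  classical
  rw [injective_iff_map_eq_zero]
  intro f hf
  ext σ
  have hσ := (mem_simplices_fullSubcomplex.mp σ.2).1
  let coeff : StanleyReisnerRing k K →ₗ[k] k :=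
    srLift k K (fun h => if h = indicatorExp σ.1 then 1 else 0) fun h hh => if_neg fun e => hh (by
      rwa [e, support_indicatorExp])
  -- `Ψ` reads off the exterior coefficient of `v_σ`; distinct simplices have distinct squarefree
  -- monomials, so it isolates `f σ` times a nonzero element.
  let Ψ : Koszul k K r →ₗ[k] Ext k r :=
    (TensorProduct.rid k _).toLinearMap ∘ₗ TensorProduct.map LinearMap.id coeff
  have h1 : ∀ τ : Finset (Fin m), Ψ (simplexElement k K α L τ) =
      if τ = σ.1 then (-1 : k) ^ orientationExponent α.color L τ • tMonomial k (L \ α.colors τ)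
      else 0 := by
    intro τ
    have h2 : indicatorExp τ = indicatorExp σ.1 ↔ τ = σ.1 :=
      ⟨fun e => by rw [← support_indicatorExp τ, e, support_indicatorExp], fun e => by rw [e]⟩
    simp only [simplexElement, Ψ, map_smul, LinearMap.comp_apply, TensorProduct.map_tmul, coeff,
      srLift_srMonomial, h2, LinearEquiv.coe_coe, TensorProduct.rid_tmul, LinearMap.id_apply]
    split_ifs <;> simp
  have h3 := congrArg Ψ hf
  rw [cochainEmbedding_apply, map_sum, map_zero,
    Finset.sum_eq_single_of_mem σ (Finset.mem_univ σ), map_smul, h1, if_pos rfl] at h3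
  · refine (smul_eq_zero.mp h3).resolve_right ?_
    exact smul_ne_zero (pow_ne_zero _ (by simp)) (tMonomial_ne_zero k _)
  · intro τ _ hτ
    rw [map_smul, h1, if_neg fun e => hτ (Subtype.ext e), smul_zero]

theorem cochainEmbedding_mem_koszulPiece (hα : α.IsNondegenerate K) (j : ℤ)
    (f : simplices (fullSubcomplex K (α.blockUnion L)) → k) (hf : f ∈ cochains k _ j) :
    cochainEmbedding k K α L f ∈ koszulPiece k K α L (j - (L.card - 1)) := by
  classical
  rw [cochainEmbedding_apply]
  refine Submodule.sum_mem _ fun σ _ => ?_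
  obtain ⟨hσ, hσω⟩ := mem_simplices_fullSubcomplex.mp σ.2
  by_cases hcard : (σ.1.card : ℤ) = j + 1
  · refine Submodule.smul_mem _ _ (Submodule.smul_mem _ _ (Submodule.subset_span
      ⟨_, _, ?_, ?_, ?_, rfl⟩))
    · rwa [support_indicatorExp]
    · rw [support_indicatorExp]
      exact Finset.union_sdiff_of_subset (colors_subset_of_subset_blockUnion hσω)
    · rw [card_sdiff_colors hα hσ hσω]
      omega
  · rw [hf σ hcard, zero_smul]
    exact zero_mem _

variable {k K α L}

theorem isReducedAt_indicatorExp (i : Fin r) (σ : Finset (Fin m)) :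
    IsReducedAt α i (L \ α.colors σ) (indicatorExp σ) := by
  refine ⟨fun j _ => ?_, fun hi => ?_⟩
  · rw [indicatorExp_apply]
    split_ifs <;> omega
  · rw [support_indicatorExp]
    exact (Finset.mem_sdiff.mp hi).2

theorem eq_of_isReducedAt {I : Finset (Fin r)} {h : Fin m →₀ ℕ}
    (hr : ∀ i, IsReducedAt α i I h) (hL : α.colors h.support ∪ I = L) :
    h = indicatorExp h.support ∧ I = L \ α.colors h.support := by
  refine ⟨eq_indicatorExp_of_le_one fun j => (hr (α.color j)).1 j (α.mem_block_iff.mpr rfl), ?_⟩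
  rw [← hL, Finset.union_sdiff_cancel_left]
  exact Finset.disjoint_right.mpr fun i hi => (hr i).2 hi

open Classical in
theorem contraction_cochainEmbedding {π : Koszul k K r →ₗ[k] Koszul k K r}
    (hπ : ∀ I h, h.support ∈ simplices K → π (tMonomial k I ⊗ₜ srMonomial k K h) =
      if ∀ i ∈ Finset.univ, IsReducedAt α i I h then tMonomial k I ⊗ₜ srMonomial k K h else 0)
    (f : simplices (fullSubcomplex K (α.blockUnion L)) → k) :
    π (cochainEmbedding k K α L f) = cochainEmbedding k K α L f := by
  rw [cochainEmbedding_apply, map_sum]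
  refine Finset.sum_congr rfl fun σ _ => ?_
  have hσ := (mem_simplices_fullSubcomplex.mp σ.2).1
  rw [map_smul, simplexElement, map_smul, hπ _ _ (by rwa [support_indicatorExp]),
    if_pos fun i _ => isReducedAt_indicatorExp i σ.1]

open Classical in
theorem exists_cochainEmbedding_eq_contraction {π : Koszul k K r →ₗ[k] Koszul k K r}
    (hα : α.IsNondegenerate K)
    (hπ : ∀ I h, h.support ∈ simplices K → π (tMonomial k I ⊗ₜ srMonomial k K h) =
      if ∀ i ∈ Finset.univ, IsReducedAt α i I h then tMonomial k I ⊗ₜ srMonomial k K h else 0)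
    (j : ℤ) (x : Koszul k K r) (hx : x ∈ koszulPiece k K α L (j - (L.card - 1))) :
    ∃ f ∈ cochains k (fullSubcomplex K (α.blockUnion L)) j,
      cochainEmbedding k K α L f = π x := by
  induction hx using Submodule.span_induction with
  | zero => exact ⟨0, zero_mem _, by simp⟩
  | add x y _ _ hx hy =>
    obtain ⟨f, hf, hfx⟩ := hx
    obtain ⟨g, hg, hgy⟩ := hy
    exact ⟨f + g, add_mem hf hg, by rw [map_add, map_add, hfx, hgy]⟩
  | smul c x _ hx =>
    obtain ⟨f, hf, hfx⟩ := hx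
    exact ⟨c • f, Submodule.smul_mem _ _ hf, by rw [map_smul, map_smul, hfx]⟩
  | mem x hx =>
    obtain ⟨I, h, hh, hL, hI, rfl⟩ := hx
    rw [hπ I h hh]
    split_ifs with hr
    · obtain ⟨hh', hI'⟩ := eq_of_isReducedAt (fun i => hr i (Finset.mem_univ i)) hL
      set σ := h.support
      have hσω : σ ⊆ α.blockUnion L := fun v hv => by
        rw [α.mem_blockUnion_iff, ← hL, α.colors_eq_image]
        exact Finset.mem_union_left _ (Finset.mem_image_of_mem _ hv)
      refine ⟨Pi.single ⟨σ, mem_simplices_fullSubcomplex.mpr ⟨hh, hσω⟩⟩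
        ((-1) ^ orientationExponent α.color L σ), fun τ hτ => Pi.single_eq_of_ne ?_ _, ?_⟩
      · rintro rfl
        apply hτ
        have h1 := card_sdiff_colors hα hh hσω
        rw [← hI'] at h1
        simp only
        omega
      -- The sign chosen as the value of the cochain is its own inverse and cancels the one in
      -- `simplexElement`.
      · rw [cochainEmbedding_single, simplexElement, smul_smul, ← mul_pow, neg_one_mul, neg_neg,
          one_pow, one_smul, ← hh', ← hI']
    · exact ⟨0, zero_mem _, map_zero _⟩

theorem nonempty_multigradedTor_equiv (hα : α.IsNondegenerate K) (q : ℕ) :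
    Nonempty (multigradedTor k K α q L ≃ₗ[k]
      reducedCohomology k (fullSubcomplex K (α.blockUnion L)) ((L.card : ℤ) - q - 1)) := by
  obtain ⟨π, hπ, hπ'⟩ := exists_isHomotopicToId k hα L Finset.univ
  exact nonempty_gradedComplex_homology_equiv _ _ _ _ _ _ _ _ (cochainEmbedding k K α L)
    (cochainEmbedding_injective k K α L) (koszulD_cochainEmbedding k K α L hα) (L.card - 1)
    (cochainEmbedding_mem_koszulPiece k K α L hα) π hπ (contraction_cochainEmbedding hπ')
    (exists_cochainEmbedding_eq_contraction hα hπ') _ _ (by ring)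

end Embedding

end ColoredTor

end

theorem mainTheorem2 {k : Type u} [Field k] {m r : ℕ} (K : AbstractSimplicialComplex (Fin m))
    (α : ColoredTor.VertexPartition m r)
    (hα : α.IsNondegenerate K.toPreAbstractSimplicialComplex)
    (q : ℕ) (L : Finset (Fin r)) :
    Nonempty (ColoredTor.multigradedTor k K.toPreAbstractSimplicialComplex α q L ≃ₗ[k]
      ColoredTor.reducedCohomology k
        (ColoredTor.fullSubcomplex K.toPreAbstractSimplicialComplex (α.blockUnion L))
        ((L.card : ℤ) - (q : ℤ) - 1)) :=
  ColoredTor.nonempty_multigradedTor_equiv hα q
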